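/- **Setting.** For $d\ge 1$ let $\mathcal X_d\subset\mathbb R^d$ be the set of centroids of faces of the standard simplex, i.e. of all $x$ with $\sum_j x_j=1$ whose coordinates all lie in $\{0,1/i\}$ for some $i\in\{1,\dots,d\}$. Let $\mathcal H_d$ be the class of halfspaces $x\mapsto \mathbf 1[\langle w,x\rangle\ge b]$ ($w\in\mathbb R^d$, $b\in\mathbb R$) on $\mathcal X_d$, and let $\mathcal Z_d=\mathcal X_d\times\{0,1\}$. A dataset $D\in\mathcal Z_d^\star$ is realizable if some $h\in\mathcal H_d$ satisfies $h(x)=y$ for every $(x,y)$ in $D$; put $f(D)=\{\text{yes}\}$ if $D$ is realizable and $f(D)=\{\text{no}\}$ otherwise. For a distribution $\mathcal D$ on datasets, an $(\varepsilon,\delta)$-learning-unlearning (LU) scheme supporting unlearning queries of size at most $k$ is a pair of randomized algorithms $(\mathsf{Learn},\mathsf{Unlearn})$ such that: (i) for every dataset $D$, $\mathsf{Learn}(D)$ outputs a solution that lies in $f(D)$ (with probability one), whose law is denoted $P_D$, and a bit string $\mathrm{aux}(D)\in\{0,1\}^\star$; (ii) for every $D$ in the support of $\mathcal D$, every set $I$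 of at most $k$ positions of $D$, and every $W'\subseteq\{\text{yes},\text{no}\}$, $$\Pr[\mathsf{Unlearn}(D_I,\mathrm{aux}(D))\in W']\le e^{\varepsilon}P_{D\setminus D_I}(W')+\delta,$$ where $D_I$ and $D\setminus D_I$ are the subsequences of $D$ on and off $I$, and the probability is over the randomness of $\mathrm{aux}(D)$ and of $\mathsf{Unlearn}$. Let $H(\delta)=\delta\log_2\frac1\delta+(1-\delta)\log_2\frac1{1-\delta}$ (with $H(0)=0$). **Theorem.** There are universal constants $c_1,c,a,b>0$ and $C\in\mathbb N$ such that for all integers $d\ge C$ and $2\le k'\le d-2$ the following holds with $n=\binom d{k'}$. There are a distribution $\rho$ on $\mathcal Z_d$ whose support has exactly $n+d$ elements, an integer $n_0\in[n/2,n]$, and an integer $k$ with $a\,k'\log d\le k\le b\,k'\log d$, such that for all $\varepsilon\ge 0$ and $\delta\in[0,1/2)$, every $(\varepsilon,\delta)$-LU scheme for $\mathcal H_d$-realizability testing, for datasets $\mathbf D$ of $n_0$ i.i.d. samples from $\rho$, that supports unlearning queries of size at most $k$ satisfies $$\mathbb E\big[|\mathrm{aux}(\mathbf D)|\big]\;\ge\;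 c\,(c_1-H(\delta))\,n,$$ where the expectation is over $\mathbf D$ and the randomness of $\mathsf{Learn}$. -/

import Mathlib

open scoped ENNReal

/-- The entropy of `Ber(p)` measured in bits (Mathlib's `Real.binEntropy` is in nats). -/
noncomputable def entropyBits (p : ℝ) : ℝ := Real.binEntropy p / Real.log 2

/-- A dataset (a finite sequence of labelled points) is `H`-realizable if some hypothesis in `H`
labels all of its points correctly. -/
def Realizable {X : Type*} (H : Set (X → Bool)) (D : List (X × Bool)) : Prop :=
  ∃ h ∈ H, ∀ z ∈ D, h z.1 = z.2

/-- The learning task of `H`-realizability testing, as a map from datasets to sets of admissible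
outcomes: the value is `{true}` (yes) if `D` is realizable and `{false}` (no) otherwise. -/
def realizabilityTesting {X : Type*} (H : Set (X → Bool)) (D : List (X × Bool)) : Set Bool :=
  {o | o = true ↔ Realizable H D}

/-- The subsequence of the dataset `D` at the positions in `I`, in the order of `D`. -/
def subDataset {Z : Type*} (D : List Z) (I : Finset (Fin D.length)) : List Z :=
  ((List.finRange D.length).filter (fun i => i ∈ I)).map D.get

/-- A pair of randomized algorithms. `learn D` is the joint law of the solution and of the
auxiliary bit string; `unlearn Q aux` is the law of the outcome on the unlearning query `Q`. -/
structure LUPair (Z : Type*) (W : Type*) where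
  learn : List Z → PMF (W × List Bool)
  unlearn : List Z → List Bool → PMF W

namespace LUPair

variable {Z : Type*} {W : Type*}

/-- The law of the solution output by `learn D`. -/
noncomputable def solutionLaw (S : LUPair Z W) (D : List Z) : PMF W :=
  (S.learn D).map Prod.fst

/-- The law of the auxiliary information output by `learn D`. -/
noncomputable def auxLaw (S : LUPair Z W) (D : List Z) : PMF (List Bool) :=
  (S.learn D).map Prod.snd

/-- The law of the outcome of `unlearn` on the query `D_I` after `learn` was run on `D`, over the
randomness of the auxiliary information and of `unlearn`. -/
noncomputable def unlearnLaw (S : LUPair Z W) (D : List Z) (I : Finset (Fin D.length)) : PMF W :=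
  (S.auxLaw D).bind fun aux => S.unlearn (subDataset D I) aux

/-- `S` is an `(ε, δ)`-learning-unlearning scheme for the task `f`, for datasets drawn from `𝒟`,
supporting unlearning queries of size at most `k`. -/
def IsScheme (S : LUPair Z W) (f : List Z → Set W) (𝒟 : PMF (List Z)) (k : ℕ) (ε δ : ℝ) : Prop :=
  (∀ D : List Z, (S.solutionLaw D).support ⊆ f D) ∧
  ∀ D ∈ 𝒟.support, ∀ I : Finset (Fin D.length), I.card ≤ k → ∀ W' : Set W,
    (S.unlearnLaw D I).toOuterMeasure W' ≤
      ENNReal.ofReal (Real.exp ε) * (S.solutionLaw (subDataset D Iᶜ)).toOuterMeasure W'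
        + ENNReal.ofReal δ

/-- The expected number of bits of auxiliary information `𝔼 |aux(D)|` for `D ∼ 𝒟`. -/
noncomputable def expectedMemory (S : LUPair Z W) (𝒟 : PMF (List Z)) : ℝ≥0∞ :=
  ∑' D : List Z, 𝒟 D * ∑' aux : List Bool, S.auxLaw D aux * (aux.length : ℝ≥0∞)

end LUPair

/-- The law of a dataset of `m` i.i.d. samples from `ρ`. -/
noncomputable def iidSamples {Z : Type*} (ρ : PMF Z) : ℕ → PMF (List Z)
  | 0 => PMF.pure []
  | m + 1 => ρ.bind fun z => (iidSamples ρ m).map fun D => z :: D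

/-- The centroids of the faces of the standard simplex in `ℝ^d`: the points all of whose
coordinates are `0` or `1 / i`, for some `1 ≤ i ≤ d`, and whose coordinates add up to `1`. -/
def simplexDomain (d : ℕ) : Set (EuclideanSpace ℝ (Fin d)) :=
  {x | ∃ i : ℕ, 1 ≤ i ∧ i ≤ d ∧ (∀ j, x j = 0 ∨ x j = 1 / (i : ℝ)) ∧ ∑ j, x j = 1}

/-- The (affine) halfspace classifiers `x ↦ 𝟙[b ≤ ⟨w, x⟩]` over the domain `X ⊆ ℝ^d`. -/
def halfspaces {d : ℕ} (X : Set (EuclideanSpace ℝ (Fin d))) : Set (X → Bool) :=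
  {h | ∃ (w : EuclideanSpace ℝ (Fin d)) (b : ℝ),
    ∀ x : X, h x = true ↔ b ≤ inner ℝ w (x : EuclideanSpace ℝ (Fin d))}

/-!
The hard distribution lives on the vertices `e_j` of the simplex, labelled `false`, and on the
centroids `x_B` of the faces with `m = d - k'` vertices, labelled `true`. Suppose that every vertex
occurs in the dataset, and unlearn all copies of the vertices outside a face `B`. What remains is
realizable if and only if `x_B` does not occur (`realizable_hardPoint_iff`): `x_B` is the mean of the
remaining vertices, but every other face with `m` vertices has a vertex outside `B`, where the weight
vector may be large. As the query only contains vertices, and `Unlearn` answers wrongly with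
probability at most `δ`, the vertices in the dataset and the auxiliary string determine the set of
all centroids in the dataset, up to an expected number of `2 δ n` errors
(`pmfExpect_decoded_wrong_le`). Each vertex has probability `2 log d / n₀`, so that with high
probability all of them occur, each at most `K = ⌈8 log d⌉` times (`pmfExpect_not_isBalanced_le`);
then the query has size at most `k' K`.

The lower bound on the memory is a counting argument. Since `H(δ) ≥ δ`, only `δ < c₁` matters, for a
small constant `c₁`, and then the number of errors is rarely as large as `n / 128`. Given the
vertices in the dataset, the remaining at least `n / 4` samples are uniform among the `n` centroids,
and all of them lie in a fixed set of size at most `n₀`, about `n / 2`, with exponentially small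
probability (`pmfExpect_rightPart_subset`). This probability beats the number of sets within distance
`n / 128` of a set decoded from a string shorter than `n / 64`
(`pmfExpect_hamming_lt_le`, `strings_mul_ball_mul_pow_le`). Hence the string is usually longer, which
`one_le_memory_add` turns into a bound on its expected length.
-/

/-! ### Expectations under probability mass functions -/

/-- The expectation of an extended nonnegative function under a probability mass function. -/
noncomputable def pmfExpect {α : Type*} (μ : PMF α) (F : α → ℝ≥0∞) : ℝ≥0∞ :=
  ∑' x, μ x * F x

section Expectation

variable {α α' : Type*} (μ : PMF α)

lemma pmfExpect_pure (a : α) (F : α → ℝ≥0∞) : pmfExpect (PMF.pure a) F = F a := by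
  unfold pmfExpect
  rw [tsum_eq_single a]
  · simp
  · intro b hb
    simp [PMF.pure_apply, hb]

lemma pmfExpect_bind (f : α → PMF α') (F : α' → ℝ≥0∞) :
    pmfExpect (μ.bind f) F = pmfExpect μ fun a => pmfExpect (f a) F := by
  unfold pmfExpect
  simp only [PMF.bind_apply, ← ENNReal.tsum_mul_right, ← ENNReal.tsum_mul_left]
  rw [ENNReal.tsum_comm]
  simp only [mul_assoc]

lemma pmfExpect_map (f : α → α') (F : α' → ℝ≥0∞) :
    pmfExpect (μ.map f) F = pmfExpect μ fun a => F (f a) := by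
  rw [← PMF.bind_pure_comp, pmfExpect_bind]
  simp [pmfExpect_pure]

lemma pmfExpect_mono {F G : α → ℝ≥0∞} (h : ∀ x, μ x ≠ 0 → F x ≤ G x) :
    pmfExpect μ F ≤ pmfExpect μ G := by
  refine ENNReal.tsum_le_tsum fun x => ?_
  by_cases hx : μ x = 0
  · simp [hx]
  · gcongr
    exact h x hx

lemma pmfExpect_congr {F G : α → ℝ≥0∞} (h : ∀ x, μ x ≠ 0 → F x = G x) :
    pmfExpect μ F = pmfExpect μ G :=
  le_antisymm (pmfExpect_mono μ fun x hx => (h x hx).le)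
    (pmfExpect_mono μ fun x hx => (h x hx).ge)

lemma pmfExpect_const (c : ℝ≥0∞) : pmfExpect μ (fun _ => c) = c := by
  unfold pmfExpect
  rw [ENNReal.tsum_mul_right, μ.tsum_coe, one_mul]

lemma pmfExpect_add (F G : α → ℝ≥0∞) :
    pmfExpect μ (fun x => F x + G x) = pmfExpect μ F + pmfExpect μ G := by
  simp only [pmfExpect, mul_add, ENNReal.tsum_add]

lemma pmfExpect_const_mul (c : ℝ≥0∞) (F : α → ℝ≥0∞) :
    pmfExpect μ (fun x => c * F x) = c * pmfExpect μ F := by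
  simp only [pmfExpect, ← ENNReal.tsum_mul_left]
  exact tsum_congr fun x => by ring

lemma pmfExpect_mul_const (F : α → ℝ≥0∞) (c : ℝ≥0∞) :
    pmfExpect μ (fun x => F x * c) = pmfExpect μ F * c := by
  simp only [mul_comm _ c, pmfExpect_const_mul]

lemma pmfExpect_finset_sum {κ : Type*} (s : Finset κ) (F : κ → α → ℝ≥0∞) :
    pmfExpect μ (fun x => ∑ i ∈ s, F i x) = ∑ i ∈ s, pmfExpect μ (F i) := by
  simp only [pmfExpect, Finset.mul_sum]
  exact Summable.tsum_finsetSum fun i _ => ENNReal.summable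

lemma pmfExpect_apply_singleton (f : α → PMF α') (b : α') :
    pmfExpect μ (fun a => f a b) = (μ.bind f).toOuterMeasure {b} := by
  rw [PMF.toOuterMeasure_apply_singleton, PMF.bind_apply, pmfExpect]

lemma pmfExpect_iidSamples_succ (m : ℕ) (F : List α → ℝ≥0∞) :
    pmfExpect (iidSamples μ (m + 1)) F =
      pmfExpect μ fun z => pmfExpect (iidSamples μ m) fun D => F (z :: D) := by
  simp only [iidSamples, pmfExpect_bind, pmfExpect_map]

lemma length_eq_of_iidSamples_ne_zero (m : ℕ) :
    ∀ D : List α, iidSamples μ m D ≠ 0 → D.length = m := by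
  induction m with
  | zero =>
    intro D hD
    have : D ∈ (PMF.pure ([] : List α)).support := hD
    simp_all
  | succ m ih =>
    intro D hD
    have hD' : D ∈ (iidSamples μ (m + 1)).support := hD
    simp only [iidSamples, PMF.mem_support_bind_iff, PMF.mem_support_map_iff] at hD'
    obtain ⟨z, -, D', hD', rfl⟩ := hD'
    simp [ih D' hD']

lemma iidSamples_map (f : α → α') (m : ℕ) :
    iidSamples (μ.map f) m = (iidSamples μ m).map (List.map f) := by
  induction m with
  | zero => simp [iidSamples, PMF.pure_map]
  | succ m ih =>
    simp only [iidSamples, ih, PMF.bind_map, PMF.map_bind, PMF.map_comp]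
    rfl

lemma pmfExpect_eq_sum [Fintype α] (F : α → ℝ≥0∞) : pmfExpect μ F = ∑ x, μ x * F x :=
  tsum_fintype _

end Expectation

/-! ### Samples with two kinds of points -/

section TwoKinds

variable {ι β : Type*}

/-- The subsequence of the points of the first kind. -/
def leftPart (D : List (ι ⊕ β)) : List ι := D.filterMap Sum.getLeft?

/-- The subsequence of the points of the second kind. -/
def rightPart (D : List (ι ⊕ β)) : List β := D.filterMap Sum.getRight?

lemma mem_leftPart {D : List (ι ⊕ β)} {j : ι} : j ∈ leftPart D ↔ Sum.inl j ∈ D := by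
  simp [leftPart]

lemma mem_rightPart {D : List (ι ⊕ β)} {b : β} : b ∈ rightPart D ↔ Sum.inr b ∈ D := by
  simp [rightPart]

@[simp] lemma leftPart_inl (j : ι) (D : List (ι ⊕ β)) :
    leftPart (Sum.inl j :: D) = j :: leftPart D := rfl

@[simp] lemma leftPart_inr (b : β) (D : List (ι ⊕ β)) :
    leftPart (Sum.inr b :: D) = leftPart D := rfl

@[simp] lemma rightPart_inl (j : ι) (D : List (ι ⊕ β)) :
    rightPart (Sum.inl j :: D) = rightPart D := rfl

@[simp] lemma rightPart_inr (b : β) (D : List (ι ⊕ β)) :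
    rightPart (Sum.inr b :: D) = b :: rightPart D := rfl

lemma length_leftPart_add_length_rightPart (D : List (ι ⊕ β)) :
    (leftPart D).length + (rightPart D).length = D.length := by
  induction D with
  | nil => rfl
  | cons z D ih => cases z <;> simp <;> omega

variable [Fintype ι] [Fintype β] [DecidableEq β]

/-- The moment generating function of the number of occurrences of one point, which is a binomial
random variable. -/
lemma pmfExpect_pow_count [DecidableEq ι] (ν : PMF (ι ⊕ β)) (j : ι) (s : ℝ≥0∞) (m : ℕ) :
    pmfExpect (iidSamples ν m) (fun D => s ^ (leftPart D).count j) =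
      (ν (Sum.inl j) * s + (1 - ν (Sum.inl j))) ^ m := by
  induction m with
  | zero => simp [iidSamples, pmfExpect_pure, leftPart]
  | succ m ih =>
    have hstep : ∀ z : ι ⊕ β,
        pmfExpect (iidSamples ν m) (fun D => s ^ (leftPart (z :: D)).count j) =
          (if z = Sum.inl j then s else 1) *
            (ν (Sum.inl j) * s + (1 - ν (Sum.inl j))) ^ m := by
      intro z
      rw [← ih, ← pmfExpect_const_mul]
      congr 1
      funext D
      rcases z with i | b
      · by_cases hij : i = j
        · subst hij
          simp [pow_succ, mul_comm]
        · simp [hij]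
      · simp
    have hrest : ∑ z ∈ Finset.univ.erase (Sum.inl j), ν z = 1 - ν (Sum.inl j) := by
      have h1 : ∑ z, ν z = 1 := by rw [← tsum_fintype (L := .unconditional _), ν.tsum_coe]
      rw [← Finset.add_sum_erase _ _ (Finset.mem_univ (Sum.inl j))] at h1
      exact ENNReal.eq_sub_of_add_eq (ν.apply_ne_top _) (by rw [add_comm]; exact h1)
    rw [pmfExpect_iidSamples_succ]
    simp only [hstep]
    rw [pmfExpect_mul_const, pow_succ', pmfExpect_eq_sum,
      ← Finset.add_sum_erase _ _ (Finset.mem_univ (Sum.inl j))]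
    congr 2
    · simp
    · rw [← hrest]
      refine Finset.sum_congr rfl fun z hz => ?_
      simp [Finset.ne_of_mem_erase hz]

/-- When the points of the second kind are uniform, each of them lies in `t` with probability
`|t| / |β|`, independently of the points of the first kind and of the number of points of the
second kind. -/
lemma pmfExpect_rightPart_subset (ν : PMF (ι ⊕ β)) (p : ℝ≥0∞) (hp : ∀ b, ν (Sum.inr b) = p)
    [Nonempty β] (t : Finset β) (m : ℕ) (φ : List ι → ℝ≥0∞) :
    pmfExpect (iidSamples ν m)
        (fun D => φ (leftPart D) * if (rightPart D).toFinset ⊆ t then 1 else 0) =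
      pmfExpect (iidSamples ν m)
        (fun D => φ (leftPart D) * (t.card / Fintype.card β : ℝ≥0∞) ^ (rightPart D).length) := by
  induction m generalizing φ with
  | zero => simp [iidSamples, pmfExpect_pure, leftPart, rightPart]
  | succ m ih =>
    rw [pmfExpect_iidSamples_succ, pmfExpect_iidSamples_succ, pmfExpect_eq_sum, pmfExpect_eq_sum,
      Fintype.sum_sum_type, Fintype.sum_sum_type]
    congr 1
    · refine Finset.sum_congr rfl fun j _ => ?_
      congr 1
      exact ih fun E => φ (j :: E)
    · set I := pmfExpect (iidSamples ν m)
        (fun D => φ (leftPart D) * (t.card / Fintype.card β : ℝ≥0∞) ^ (rightPart D).length)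
        with hI
      have h1 : ∀ b, pmfExpect (iidSamples ν m) (fun D => φ (leftPart (Sum.inr b :: D)) *
          if (rightPart (Sum.inr b :: D)).toFinset ⊆ t then 1 else 0) =
          (if b ∈ t then 1 else 0) * I := by
        intro b
        by_cases hb : b ∈ t
        · rw [hI, ← ih φ]
          simp [hb, Finset.insert_subset_iff]
        · simp [hb, Finset.insert_subset_iff, pmfExpect_const]
      have h2 : ∀ b, pmfExpect (iidSamples ν m) (fun D => φ (leftPart (Sum.inr b :: D)) *
          (t.card / Fintype.card β : ℝ≥0∞) ^ (rightPart (Sum.inr b :: D)).length) =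
          (t.card / Fintype.card β : ℝ≥0∞) * I := by
        intro b
        rw [hI, ← pmfExpect_const_mul]
        congr 1
        funext D
        simp only [leftPart_inr, rightPart_inr, List.length_cons]
        ring
      simp only [h1, h2, hp, ← Finset.mul_sum, ← Finset.sum_mul]
      congr 1
      rw [Finset.sum_const, Finset.card_univ, nsmul_eq_mul, ← mul_assoc,
        ENNReal.div_mul_cancel (by simp) (by simp)]
      simp

end TwoKinds

/-! ### Counting strings and Hamming balls -/

/-- There are fewer than `2 ^ ℓ` bit strings of length less than `ℓ`. -/
lemma exists_finset_strings (ℓ : ℕ) :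
    ∃ s : Finset (List Bool), (∀ a : List Bool, a.length < ℓ → a ∈ s) ∧ s.card + 1 ≤ 2 ^ ℓ := by
  induction ℓ with
  | zero => exact ⟨∅, by simp, by simp⟩
  | succ ℓ ih =>
    obtain ⟨s, hs, hc⟩ := ih
    refine ⟨insert [] (s.image (List.cons true) ∪ s.image (List.cons false)), ?_, ?_⟩
    · rintro (_ | ⟨_ | _, a⟩) ha
      · simp
      · simpa using hs a (by simpa using ha)
      · simpa using hs a (by simpa using ha)
    · have h1 := Finset.card_insert_le ([] : List Bool)
        (s.image (List.cons true) ∪ s.image (List.cons false))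
      have h2 := Finset.card_union_le (s.image (List.cons true)) (s.image (List.cons false))
      have h3 := Finset.card_image_le (s := s) (f := List.cons true)
      have h4 := Finset.card_image_le (s := s) (f := List.cons false)
      rw [pow_succ]
      omega

/-- The Hamming ball of radius `r` in the cube of dimension `n` has size at most
`(1 + x) ^ n / x ^ r` for all `0 < x ≤ 1`; here with `x = 1 / 32`. -/
lemma card_hammingBall_le {β : Type*} [Fintype β] [DecidableEq β] (g : Finset β) (r : ℕ) :
    ((Finset.univ.filter fun t : Finset β => (symmDiff t g).card < r).card : ℝ) ≤
      32 ^ r * (33 / 32 : ℝ) ^ Fintype.card β := by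
  have hsum : ∑ t : Finset β, (1 / 32 : ℝ) ^ (symmDiff t g).card =
      (33 / 32 : ℝ) ^ Fintype.card β := by
    have hinv : Function.Involutive fun t : Finset β => symmDiff t g := fun t => by simp
    refine (Equiv.sum_comp hinv.toPerm fun t : Finset β => (1 / 32 : ℝ) ^ t.card).trans ?_
    have h := Fintype.sum_pow_mul_eq_add_pow β (1 / 32 : ℝ) 1
    norm_num at h ⊢
    exact h
  rw [← hsum, Finset.mul_sum, Finset.card_eq_sum_ones, Nat.cast_sum]
  refine le_trans (Finset.sum_le_sum (g := fun t => 32 ^ r * (1 / 32 : ℝ) ^ (symmDiff t g).card)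
    fun t ht => ?_) (Finset.sum_le_univ_sum_of_nonneg fun t => by positivity)
  have ht' := (Finset.mem_filter.1 ht).2
  obtain ⟨e, rfl⟩ := Nat.exists_eq_add_of_lt ht'
  rw [add_assoc, pow_add, mul_right_comm, ← mul_pow]
  norm_num
  exact one_le_pow₀ (by norm_num)

/-! ### Sub-datasets and unlearning queries -/

section Queries

variable {Z : Type*}

lemma subDataset_filter (D : List Z) (p : Z → Bool) :
    subDataset D (Finset.univ.filter fun i => p (D.get i) = true) = D.filter p := by
  have h : D.filter p = ((List.finRange D.length).map D.get).filter p := by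
    rw [List.map_get_finRange]
  rw [h, List.filter_map]
  simp [subDataset, Function.comp_def]

lemma subDataset_compl_filter (D : List Z) (p : Z → Bool) :
    subDataset D (Finset.univ.filter fun i => p (D.get i) = true)ᶜ = D.filter fun z => !p z := by
  rw [← subDataset_filter]
  congr 1
  ext i
  simp

lemma length_subDataset (D : List Z) (I : Finset (Fin D.length)) :
    (subDataset D I).length = I.card := by
  have hnd : ((List.finRange D.length).filter (fun i => i ∈ I)).Nodup :=
    (List.nodup_finRange _).filter _
  rw [subDataset, List.length_map, ← List.toFinset_card_of_nodup hnd]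
  congr 1
  ext i
  simp

/-- The scheme answers a query wrongly with probability at most `δ`: a wrong answer is never output
when learning from scratch. -/
lemma LUPair.IsScheme.unlearnLaw_wrong_le {X : Type*} {H : Set (X → Bool)}
    {S : LUPair (X × Bool) Bool} {𝒟 : PMF (List (X × Bool))} {k : ℕ} {ε δ : ℝ}
    (hS : S.IsScheme (realizabilityTesting H) 𝒟 k ε δ) {D : List (X × Bool)} (hD : 𝒟 D ≠ 0)
    {I : Finset (Fin D.length)} (hI : I.card ≤ k) {o : Bool}
    (ho : o = true ↔ ¬ Realizable H (subDataset D Iᶜ)) :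
    (S.unlearnLaw D I).toOuterMeasure {o} ≤ ENNReal.ofReal δ := by
  have hzero : (S.solutionLaw (subDataset D Iᶜ)).toOuterMeasure {o} = 0 := by
    rw [PMF.toOuterMeasure_apply_singleton, PMF.apply_eq_zero_iff]
    intro hmem
    have := hS.1 _ hmem
    simp only [realizabilityTesting, Set.mem_ofPred_eq] at this
    tauto
  simpa [hzero] using hS.2 D hD I hI {o}

end Queries

/-! ### Vertices and centroids -/

section Geometry

variable {d m : ℕ}

/-- The centroid of the face of the standard simplex spanned by the vertices in `A`. -/
noncomputable def faceCentroid (A : Finset (Fin d)) : EuclideanSpace ℝ (Fin d) :=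
  WithLp.toLp 2 fun j => if j ∈ A then 1 / (A.card : ℝ) else 0

lemma faceCentroid_mem {A : Finset (Fin d)} (hA : A.Nonempty) :
    faceCentroid A ∈ simplexDomain d := by
  refine ⟨A.card, hA.card_pos, by simpa using A.card_le_univ, fun j => ?_, ?_⟩
  · by_cases hj : j ∈ A <;> simp [faceCentroid, hj]
  · have : (A.card : ℝ) ≠ 0 := by exact_mod_cast hA.card_pos.ne'
    simp [faceCentroid, this]

lemma faceCentroid_injOn {A B : Finset (Fin d)} (hA : A.Nonempty) (hB : B.Nonempty)
    (h : faceCentroid A = faceCentroid B) : A = B := by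
  ext j
  have hj : faceCentroid A j = faceCentroid B j := by rw [h]
  by_cases h1 : j ∈ A <;> by_cases h2 : j ∈ B <;>
    simp [faceCentroid, h1, h2, hA.ne_empty] at hj ⊢
  exact hB.card_pos.ne (by exact_mod_cast hj)

lemma inner_faceCentroid (w : EuclideanSpace ℝ (Fin d)) (A : Finset (Fin d)) :
    inner ℝ w (faceCentroid A) = (∑ j ∈ A, w j) / A.card := by
  simp [PiLp.inner_apply, faceCentroid, Finset.mul_sum, div_eq_inv_mul]

/-- The labelled points of the hard distribution: the vertices, with label `false`, and the
centroids of the faces with `m` vertices, with label `true`. -/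
noncomputable def hardPoint (hm : 0 < m) :
    Fin d ⊕ {B : Finset (Fin d) // B.card = m} → simplexDomain d × Bool
  | .inl j => (⟨faceCentroid {j}, faceCentroid_mem (Finset.singleton_nonempty j)⟩, false)
  | .inr B => (⟨faceCentroid B.1, faceCentroid_mem (Finset.card_pos.1 (B.2.symm ▸ hm))⟩, true)

lemma hardPoint_injective (hm : 0 < m) : Function.Injective (hardPoint (d := d) hm) := by
  rintro (i | A) (j | B) h
  · simp only [hardPoint, Prod.mk.injEq, Subtype.mk.injEq, and_true] at h
    have := faceCentroid_injOn (Finset.singleton_nonempty i) (Finset.singleton_nonempty j) h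
    simpa using this
  · simp [hardPoint] at h
  · simp [hardPoint] at h
  · simp only [hardPoint, Prod.mk.injEq, Subtype.mk.injEq, and_true] at h
    have := faceCentroid_injOn (Finset.card_pos.1 (A.2.symm ▸ hm))
      (Finset.card_pos.1 (B.2.symm ▸ hm)) h
    exact congrArg Sum.inr (Subtype.ext this)

/-- If the vertices in a dataset are exactly those of the face `B`, then the dataset is realizable
if and only if it does not contain the centroid of `B`: this centroid is a convex combination of the
vertices, while any other face of the same dimension has a vertex outside `B`. -/
lemma realizable_hardPoint_iff (hm : 0 < m) (D : List (Fin d ⊕ {B : Finset (Fin d) // B.card = m}))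
    (B : {B : Finset (Fin d) // B.card = m}) (hD : ∀ j, Sum.inl j ∈ D ↔ j ∈ B.1) :
    Realizable (halfspaces (simplexDomain d)) (D.map (hardPoint hm)) ↔ Sum.inr B ∉ D := by
  constructor
  · rintro ⟨h, ⟨w, b, hw⟩, hh⟩ hB
    have hvert : ∀ j ∈ B.1, w j < b := by
      intro j hj
      have h1 := hh _ (List.mem_map_of_mem ((hD j).2 hj))
      have h2 := hw (hardPoint hm (Sum.inl j : Fin d ⊕ {B : Finset (Fin d) // B.card = m})).1
      rw [h1] at h2
      simpa [hardPoint, inner_faceCentroid] using h2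
    have hcent := (hw _).1 (hh _ (List.mem_map_of_mem hB))
    have hne : B.1.Nonempty := Finset.card_pos.1 (B.2.symm ▸ hm)
    have hpos : (0 : ℝ) < B.1.card := by exact_mod_cast hne.card_pos
    simp only [hardPoint, inner_faceCentroid] at hcent
    rw [le_div_iff₀ hpos] at hcent
    have hlt := Finset.sum_lt_sum_of_nonempty hne hvert
    rw [Finset.sum_const, nsmul_eq_mul] at hlt
    linarith
  · intro hB
    -- The weight `-1` on `B` and `m` off `B` separates: one vertex off `B` outweighs `m - 1` on `B`.
    let w : EuclideanSpace ℝ (Fin d) := WithLp.toLp 2 fun j => if j ∈ B.1 then -1 else (m : ℝ)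
    have hwj : ∀ j, w j = if j ∈ B.1 then -1 else (m : ℝ) := fun j => rfl
    refine ⟨fun x => decide (0 ≤ inner ℝ w (x : EuclideanSpace ℝ (Fin d))), ⟨w, 0, by simp⟩, ?_⟩
    intro z hz'
    obtain ⟨z, hz, rfl⟩ := List.mem_map.1 hz'
    rcases z with j | A
    · simp [hardPoint, inner_faceCentroid, hwj, (hD j).1 hz]
    · have hAB : ¬ A.1 ⊆ B.1 := by
        intro hsub
        have : A = B := Subtype.ext (Finset.eq_of_subset_of_card_le hsub (by rw [A.2, B.2]))
        exact hB (this ▸ hz)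
      obtain ⟨i, hiA, hiB⟩ := Finset.not_subset.1 hAB
      have hrest : ∑ j ∈ A.1.erase i, (-1 : ℝ) ≤ ∑ j ∈ A.1.erase i, w j := by
        refine Finset.sum_le_sum fun j _ => ?_
        rw [hwj]
        split_ifs
        · exact le_rfl
        · linarith [(Nat.cast_nonneg m : (0 : ℝ) ≤ m)]
      rw [Finset.sum_const, Finset.card_erase_of_mem hiA, A.2, nsmul_eq_mul,
        Nat.cast_pred hm] at hrest
      have hi : w i = m := by simp [hwj, hiB]
      have hsum : 0 ≤ ∑ j ∈ A.1, w j := by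
        rw [← Finset.add_sum_erase _ _ hiA, hi]
        linarith
      simp only [hardPoint, inner_faceCentroid, decide_eq_true_eq]
      positivity

end Geometry

/-! ### Decoding the auxiliary information -/

section Decoding

variable {d m : ℕ}

/-- The unlearning query associated with the face `B`, when `E` is the sequence of vertices in the
dataset: all occurrences of vertices outside `B`. It does not depend on the centroids. -/
noncomputable def faceQuery (hm : 0 < m) (E : List (Fin d))
    (B : {B : Finset (Fin d) // B.card = m}) : List (simplexDomain d × Bool) :=
  (E.filter fun j => j ∉ B.1).map fun j => hardPoint hm (.inl j)

open Classical in
/-- The set of faces declared to have their centroid in the dataset, by unlearning the query of each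
face with the auxiliary information `aux`: those for which the answer "realizable" has probability
less than one half. -/
noncomputable def decodedFaces (hm : 0 < m) (S : LUPair (simplexDomain d × Bool) Bool)
    (aux : List Bool) (E : List (Fin d)) : Finset {B : Finset (Fin d) // B.card = m} :=
  Finset.univ.filter fun B => S.unlearn (faceQuery hm E B) aux true < 2⁻¹

/-- The vertex sequence `E` is balanced: each vertex occurs at least once and at most `K` times. -/
def IsBalanced (K : ℕ) (E : List (Fin d)) : Prop := ∀ j, 1 ≤ E.count j ∧ E.count j ≤ K

/-- A face is decoded wrongly with probability at most `2 δ` over the auxiliary information. -/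
lemma pmfExpect_decoded_wrong_le (hm : 0 < m) {S : LUPair (simplexDomain d × Bool) Bool}
    {𝒟 : PMF (List (simplexDomain d × Bool))} {k K : ℕ} {ε δ : ℝ}
    (hS : S.IsScheme (realizabilityTesting (halfspaces (simplexDomain d))) 𝒟 k ε δ)
    (hk : (d - m) * K ≤ k) {D : List (Fin d ⊕ {B : Finset (Fin d) // B.card = m})}
    (hD : 𝒟 (D.map (hardPoint hm)) ≠ 0) (hbal : IsBalanced K (leftPart D))
    (B : {B : Finset (Fin d) // B.card = m}) :
    pmfExpect (S.auxLaw (D.map (hardPoint hm))) (fun aux =>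
      if B ∈ symmDiff (rightPart D).toFinset (decodedFaces hm S aux (leftPart D)) then 1 else 0)
      ≤ 2 * ENNReal.ofReal δ := by
  classical
  let p : simplexDomain d × Bool → Bool := fun z =>
    decide (∃ j, j ∉ B.1 ∧ z = hardPoint hm (.inl j : Fin d ⊕ {B : Finset (Fin d) // B.card = m}))
  let I : Finset (Fin (D.map (hardPoint hm)).length) :=
    Finset.univ.filter fun i => p ((D.map (hardPoint hm)).get i) = true
  have hpl : ∀ j : Fin d, p (hardPoint hm
      (.inl j : Fin d ⊕ {B : Finset (Fin d) // B.card = m})) = decide (j ∉ B.1) := by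
    intro j
    simp only [p, decide_eq_decide]
    constructor
    · rintro ⟨i, hi, h⟩
      have := hardPoint_injective hm h
      simp only [Sum.inl.injEq] at this
      exact this ▸ hi
    · exact fun h => ⟨j, h, rfl⟩
  have hpr : ∀ A : {B : Finset (Fin d) // B.card = m}, p (hardPoint hm (.inr A)) = false := by
    intro A
    simp [p, hardPoint]
  have hquery : subDataset (D.map (hardPoint hm)) I = faceQuery hm (leftPart D) B := by
    rw [subDataset_filter, faceQuery]
    clear hD hbal I
    induction D with
    | nil => rfl
    | cons z D ih =>
      rcases z with j | A
      · by_cases hj : j ∈ B.1 <;> simp [hpl, hj, ih]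
      · simp [hpr, ih]
  have hcard : I.card ≤ k := by
    rw [← length_subDataset, hquery, faceQuery, List.length_map]
    refine le_trans ?_ hk
    have hcount : ((leftPart D).filter fun j => j ∉ B.1).length =
        ∑ j ∈ B.1ᶜ, (leftPart D).count j := by
      rw [← Multiset.coe_card, ← Multiset.sum_count_eq_card (s := B.1ᶜ)]
      · refine Finset.sum_congr rfl fun j hj => ?_
        rw [Multiset.coe_count, List.count_filter]
        simpa using hj
      · simp
    rw [hcount]
    refine (Finset.sum_le_card_nsmul _ _ K fun j _ => (hbal j).2).trans ?_
    rw [Finset.card_compl, B.2, Fintype.card_fin, smul_eq_mul]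
  have hcompl : subDataset (D.map (hardPoint hm)) Iᶜ =
      (D.filter fun z => !p (hardPoint hm z)).map (hardPoint hm) := by
    rw [subDataset_compl_filter, List.filter_map]
    rfl
  have hreal : Realizable (halfspaces (simplexDomain d)) (subDataset (D.map (hardPoint hm)) Iᶜ) ↔
      B ∉ (rightPart D).toFinset := by
    rw [hcompl, realizable_hardPoint_iff hm _ B]
    · simp [hpr, mem_rightPart]
    · intro j
      have : Sum.inl j ∈ D := by
        rw [← mem_leftPart]
        exact List.count_pos_iff.1 (hbal j).1
      simp [hpl, this]
  -- The wrong answer, `true` exactly if the centroid of `B` occurs, has probability at least one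
  -- half whenever `B` is decoded wrongly.
  set o : Bool := decide (B ∈ (rightPart D).toFinset) with ho
  have hwrong := hS.unlearnLaw_wrong_le hD hcard (o := o) (by rw [hreal, ho]; simp)
  rw [LUPair.unlearnLaw, ← pmfExpect_apply_singleton, hquery] at hwrong
  refine le_trans ?_ (mul_le_mul_right hwrong 2)
  rw [← pmfExpect_const_mul]
  refine pmfExpect_mono _ fun aux _ => ?_
  have hhalf : ∀ x : ℝ≥0∞, 2⁻¹ ≤ x → 1 ≤ 2 * x := by
    intro x hx
    calc (1 : ℝ≥0∞) = 2 * 2⁻¹ := (ENNReal.mul_inv_cancel (by simp) (by simp)).symm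
      _ ≤ 2 * x := by gcongr
  split_ifs with hmem
  · refine hhalf _ ?_
    rw [Finset.mem_symmDiff] at hmem
    by_cases hB : B ∈ (rightPart D).toFinset
    · have h1 : B ∉ decodedFaces hm S aux (leftPart D) := by tauto
      simp only [ho, hB, decide_true]
      simpa [decodedFaces] using h1
    · have h1 : B ∈ decodedFaces hm S aux (leftPart D) := by tauto
      simp only [ho, hB, decide_false]
      have h2 : S.unlearn (faceQuery hm (leftPart D) B) aux true < 2⁻¹ := by
        simpa [decodedFaces] using h1
      have h3 := (S.unlearn (faceQuery hm (leftPart D) B) aux).tsum_coe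
      rw [tsum_fintype, Fintype.sum_bool] at h3
      by_contra! h4
      have h5 := ENNReal.add_lt_add h2 h4
      rw [h3, ENNReal.inv_two_add_inv_two] at h5
      exact lt_irrefl _ h5
  · exact zero_le
end Decoding

/-! ### The memory of a scheme -/

section Memory

variable {d m : ℕ}

lemma IsBalanced.length_le {K : ℕ} {E : List (Fin d)} (hE : IsBalanced K E) :
    E.length ≤ d * K := by
  rw [← Multiset.coe_card, ← Multiset.sum_count_eq_card (s := Finset.univ) (by simp)]
  refine (Finset.sum_le_card_nsmul _ _ K fun j _ => ?_).trans (by simp)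
  rw [Multiset.coe_count]
  exact (hE j).2

open Classical in
/-- A union bound over the vertices, with the moments `𝔼 0 ^ X` and `𝔼 2 ^ X` of the number `X` of
occurrences of a vertex. -/
lemma pmfExpect_not_isBalanced_le {β : Type*} [Fintype β] (ν : PMF (Fin d ⊕ β)) (q : ℝ≥0∞)
    (hq : ∀ j, ν (.inl j) = q) (K N : ℕ) :
    pmfExpect (iidSamples ν N) (fun D => if IsBalanced K (leftPart D) then 0 else 1) ≤
      d * ((1 - q) ^ N + (q * 2 + (1 - q)) ^ N * (2 ^ K)⁻¹) := by
  have hle : ∀ D : List (Fin d ⊕ β), (if IsBalanced K (leftPart D) then (0 : ℝ≥0∞) else 1) ≤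
      ∑ j : Fin d, (0 ^ (leftPart D).count j + 2 ^ (leftPart D).count j * (2 ^ K)⁻¹) := by
    intro D
    split_ifs with h
    · exact zero_le
    · simp only [IsBalanced, not_forall] at h
      obtain ⟨j, hj⟩ := h
      refine le_trans ?_ (Finset.single_le_sum
        (f := fun j : Fin d =>
          (0 ^ (leftPart D).count j + 2 ^ (leftPart D).count j * (2 ^ K)⁻¹ : ℝ≥0∞))
        (fun _ _ => zero_le) (Finset.mem_univ j))
      by_cases h0 : (leftPart D).count j = 0
      · simp [h0]
      · have hK : K ≤ (leftPart D).count j := by omega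
        refine le_add_left ?_
        rw [← ENNReal.mul_inv_cancel (a := 2 ^ K) (by simp) (by simp)]
        gcongr
        norm_num
  refine (pmfExpect_mono _ fun D _ => hle D).trans_eq ?_
  rw [pmfExpect_finset_sum]
  simp only [pmfExpect_add, pmfExpect_mul_const, pmfExpect_pow_count, hq]
  simp [mul_add]

open Classical in
/-- A guess `g` for the set of centroids in the sample, based only on the vertices in the sample,
has Hamming error less than `r` with small probability. A candidate set `t` has at most `N` elements
and contains all of the at least `N - d K` uniform samples with probability at most
`(N / |β|) ^ (N - d K)`. -/
lemma pmfExpect_hamming_lt_le {β : Type*} [Fintype β] [DecidableEq β] [Nonempty β]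
    (ν : PMF (Fin d ⊕ β))
    (p : ℝ≥0∞) (hp : ∀ b, ν (.inr b) = p) (K N r : ℕ) (hN : N ≤ Fintype.card β)
    (g : List (Fin d) → Finset β) :
    pmfExpect (iidSamples ν N) (fun D => if IsBalanced K (leftPart D) ∧
        (symmDiff (rightPart D).toFinset (g (leftPart D))).card < r then 1 else 0) ≤
      ENNReal.ofReal (32 ^ r * (33 / 32) ^ Fintype.card β) *
        (N / Fintype.card β : ℝ≥0∞) ^ (N - d * K) := by
  let φ : Finset β → List (Fin d) → ℝ≥0∞ := fun t E =>
    if IsBalanced K E ∧ (symmDiff t (g E)).card < r ∧ t.card ≤ N then 1 else 0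
  have h1 : ∀ D, iidSamples ν N D ≠ 0 → (if IsBalanced K (leftPart D) ∧
        (symmDiff (rightPart D).toFinset (g (leftPart D))).card < r then (1 : ℝ≥0∞) else 0) ≤
      ∑ t : Finset β, φ t (leftPart D) * if (rightPart D).toFinset ⊆ t then 1 else 0 := by
    intro D hD
    split_ifs with h
    · refine le_trans ?_ (Finset.single_le_sum (f := fun t : Finset β =>
        φ t (leftPart D) * if (rightPart D).toFinset ⊆ t then 1 else 0)
        (fun _ _ => zero_le) (Finset.mem_univ (rightPart D).toFinset))
      have hcard : (rightPart D).toFinset.card ≤ N := by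
        have h2 := length_leftPart_add_length_rightPart D
        rw [length_eq_of_iidSamples_ne_zero ν N D hD] at h2
        exact (List.toFinset_card_le _).trans (by omega)
      simp [φ, h.1, h.2, hcard]
    · exact zero_le
  refine (pmfExpect_mono _ h1).trans ?_
  rw [pmfExpect_finset_sum]
  simp only [pmfExpect_rightPart_subset ν p hp]
  rw [← pmfExpect_finset_sum, ← pmfExpect_const (iidSamples ν N) (ENNReal.ofReal _ * _)]
  refine pmfExpect_mono _ fun D hD => ?_
  have h3 : ∀ t : Finset β, φ t (leftPart D) *
      (t.card / Fintype.card β : ℝ≥0∞) ^ (rightPart D).length ≤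
      (if (symmDiff t (g (leftPart D))).card < r then 1 else 0) *
        (N / Fintype.card β : ℝ≥0∞) ^ (N - d * K) := by
    intro t
    by_cases h : IsBalanced K (leftPart D) ∧ (symmDiff t (g (leftPart D))).card < r ∧ t.card ≤ N
    · simp only [φ, h, and_self, if_true, one_mul]
      have hlen : N - d * K ≤ (rightPart D).length := by
        have h2 := length_leftPart_add_length_rightPart D
        rw [length_eq_of_iidSamples_ne_zero ν N D hD] at h2
        have := h.1.length_le
        omega
      have hle1 : (N / Fintype.card β : ℝ≥0∞) ≤ 1 :=
        ENNReal.div_le_of_le_mul (by rw [one_mul]; exact_mod_cast hN)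
      calc (t.card / Fintype.card β : ℝ≥0∞) ^ (rightPart D).length
          ≤ (N / Fintype.card β : ℝ≥0∞) ^ (rightPart D).length := by
            gcongr
            exact h.2.2
        _ ≤ _ := pow_le_pow_right_of_le_one' hle1 hlen
    · simp [φ, h]
  refine (Finset.sum_le_sum fun t _ => h3 t).trans ?_
  rw [← Finset.sum_mul]
  gcongr
  rw [Finset.sum_boole, ← ENNReal.ofReal_natCast]
  exact ENNReal.ofReal_le_ofReal (card_hammingBall_le _ _)

open Classical in
/-- The trade-off between the expected memory and the other ways in which decoding can go wrong: the
sample is not balanced, at least `r` faces are decoded wrongly, or one of the few strings shorter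
than `ℓ` describes the set of centroids up to `r` errors. -/
lemma one_le_memory_add (hm : 0 < m) (hmd : m ≤ d)
    (ν : PMF (Fin d ⊕ {B : Finset (Fin d) // B.card = m})) (p : ℝ≥0∞)
    (hp : ∀ B, ν (.inr B) = p) {k K N ℓ r : ℕ} (hk : (d - m) * K ≤ k) (hN : N ≤ d.choose m)
    (hℓ : 0 < ℓ) (hr : 0 < r) {ε δ : ℝ} {S : LUPair (simplexDomain d × Bool) Bool}
    (hS : S.IsScheme (realizabilityTesting (halfspaces (simplexDomain d)))
      (iidSamples (ν.map (hardPoint hm)) N) k ε δ) :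
    1 ≤ pmfExpect (iidSamples ν N) (fun D => if IsBalanced K (leftPart D) then 0 else 1) +
      (S.expectedMemory (iidSamples (ν.map (hardPoint hm)) N) * (ℓ : ℝ≥0∞)⁻¹ +
        d.choose m * (2 * ENNReal.ofReal δ) * (r : ℝ≥0∞)⁻¹ +
        2 ^ ℓ * (ENNReal.ofReal (32 ^ r * (33 / 32) ^ d.choose m) *
          (N / d.choose m : ℝ≥0∞) ^ (N - d * K))) := by
  obtain ⟨s, hs, hcard⟩ := exists_finset_strings ℓ
  have hβ : Fintype.card {B : Finset (Fin d) // B.card = m} = d.choose m := by simp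
  have : Nonempty {B : Finset (Fin d) // B.card = m} := by
    rw [← Fintype.card_pos_iff, hβ]
    exact Nat.choose_pos hmd
  let wrong : List (Fin d ⊕ {B : Finset (Fin d) // B.card = m}) → List Bool →
      Finset {B : Finset (Fin d) // B.card = m} := fun D aux =>
    symmDiff (rightPart D).toFinset (decodedFaces hm S aux (leftPart D))
  -- For a balanced dataset the three remaining alternatives are weighed by Markov's inequality.
  have hD : ∀ D, iidSamples ν N D ≠ 0 → (1 : ℝ≥0∞) ≤
      (if IsBalanced K (leftPart D) then 0 else 1) +
      (pmfExpect (S.auxLaw (D.map (hardPoint hm))) (fun aux => (aux.length : ℝ≥0∞)) *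
          (ℓ : ℝ≥0∞)⁻¹ +
        d.choose m * (2 * ENNReal.ofReal δ) * (r : ℝ≥0∞)⁻¹ +
        ∑ aux ∈ s, if IsBalanced K (leftPart D) ∧ (wrong D aux).card < r then 1 else 0) := by
    intro D hD
    by_cases hbal : IsBalanced K (leftPart D)
    swap
    · simp [hbal]
    have hD' : iidSamples (ν.map (hardPoint hm)) N (D.map (hardPoint hm)) ≠ 0 := by
      rw [iidSamples_map, ← PMF.mem_support_iff, PMF.mem_support_map_iff]
      exact ⟨D, hD, rfl⟩
    set μ := S.auxLaw (D.map (hardPoint hm)) with hμ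
    have hmark : ∀ (a b : ℕ), 0 < b → b ≤ a → (1 : ℝ≥0∞) ≤ a * (b : ℝ≥0∞)⁻¹ := by
      intro a b hb hab
      rw [← ENNReal.mul_inv_cancel (a := (b : ℝ≥0∞)) (by exact_mod_cast hb.ne') (by simp)]
      gcongr
    have hsum : pmfExpect μ (fun aux => ((wrong D aux).card : ℝ≥0∞)) ≤
        d.choose m * (2 * ENNReal.ofReal δ) := by
      have hw : ∀ aux, ((wrong D aux).card : ℝ≥0∞) =
          ∑ B, if B ∈ wrong D aux then 1 else 0 := by
        intro aux
        rw [Finset.sum_boole, Finset.filter_univ_mem]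
      rw [pmfExpect_congr μ fun aux _ => hw aux, pmfExpect_finset_sum]
      refine (Finset.sum_le_sum fun B _ =>
        pmfExpect_decoded_wrong_le hm hS hk hD' hbal B).trans_eq ?_
      rw [Finset.sum_const, Finset.card_univ, hβ, nsmul_eq_mul]
    have hpt : ∀ aux : List Bool, (1 : ℝ≥0∞) ≤ aux.length * (ℓ : ℝ≥0∞)⁻¹ +
        (wrong D aux).card * (r : ℝ≥0∞)⁻¹ +
        ∑ aux' ∈ s, if aux' = aux then
          (if IsBalanced K (leftPart D) ∧ (wrong D aux').card < r then 1 else 0) else 0 := by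
      intro aux
      by_cases h1 : ℓ ≤ aux.length
      · exact le_add_right (le_add_right (hmark _ _ hℓ h1))
      by_cases h2 : r ≤ (wrong D aux).card
      · exact le_add_right (le_add_left (hmark _ _ hr h2))
      · refine le_add_left ?_
        rw [Finset.sum_ite_eq', if_pos (hs aux (by omega)), if_pos ⟨hbal, by omega⟩]
    have hexp := pmfExpect_mono μ fun aux _ => hpt aux
    rw [pmfExpect_const, pmfExpect_add, pmfExpect_add, pmfExpect_mul_const, pmfExpect_mul_const,
      pmfExpect_finset_sum] at hexp
    rw [if_pos hbal, zero_add]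
    refine hexp.trans ?_
    gcongr with aux' _
    refine (pmfExpect_mono μ fun aux _ => ?_).trans_eq (pmfExpect_const μ _)
    split_ifs <;> simp
  have hall := pmfExpect_mono _ hD
  rw [pmfExpect_const, pmfExpect_add, pmfExpect_add, pmfExpect_add, pmfExpect_mul_const,
    pmfExpect_const, pmfExpect_finset_sum] at hall
  have hmem : pmfExpect (iidSamples ν N) (fun D =>
      pmfExpect (S.auxLaw (D.map (hardPoint hm))) fun aux => (aux.length : ℝ≥0∞)) =
      S.expectedMemory (iidSamples (ν.map (hardPoint hm)) N) := by
    rw [iidSamples_map]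
    exact (pmfExpect_map (iidSamples ν N) (List.map (hardPoint hm)) (fun D =>
      pmfExpect (S.auxLaw D) fun aux => (aux.length : ℝ≥0∞))).symm
  have hham : ∑ aux ∈ s, pmfExpect (iidSamples ν N) (fun D =>
      if IsBalanced K (leftPart D) ∧ (wrong D aux).card < r then 1 else 0) ≤
      2 ^ ℓ * (ENNReal.ofReal (32 ^ r * (33 / 32) ^ d.choose m) *
          (N / d.choose m : ℝ≥0∞) ^ (N - d * K)) := by
    have hle : ∀ aux, pmfExpect (iidSamples ν N) (fun D =>
        if IsBalanced K (leftPart D) ∧ (wrong D aux).card < r then 1 else 0) ≤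
        ENNReal.ofReal (32 ^ r * (33 / 32) ^ d.choose m) *
          (N / d.choose m : ℝ≥0∞) ^ (N - d * K) := by
      intro aux
      rw [← hβ] at hN ⊢
      exact pmfExpect_hamming_lt_le ν p hp K N r hN (decodedFaces hm S aux)
    refine (Finset.sum_le_sum fun aux _ => hle aux).trans ?_
    rw [Finset.sum_const, nsmul_eq_mul]
    gcongr
    exact_mod_cast (Nat.le_succ _).trans hcard
  rw [hmem] at hall
  exact hall.trans (by gcongr)

end Memory

/-! ### Numerical estimates -/

lemma choose_two_le_choose : ∀ {d m : ℕ}, 2 ≤ m → m + 2 ≤ d → d.choose 2 ≤ d.choose m := by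
  intro d
  induction d with
  | zero => omega
  | succ d ih =>
    intro m hm hmd
    rcases eq_or_lt_of_le hm with rfl | hm'
    · exact le_rfl
    rcases eq_or_lt_of_le hmd with h | hmd'
    · rw [Nat.choose_symm_of_eq_add (n := d + 1) (a := 2) (b := m) (by omega)]
    obtain ⟨m, rfl⟩ : ∃ m', m = m' + 1 := ⟨m - 1, by omega⟩
    rw [Nat.choose_succ_succ' d m, Nat.choose_succ_succ' d 1, Nat.choose_one_right]
    have h1 := ih (m := m) (by omega) (by omega)
    have h2 := ih (m := m + 1) (by omega) (by omega)
    have h3 : d ≤ d.choose 2 := by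
      rw [Nat.choose_two_right, Nat.le_div_iff_mul_le (by norm_num)]
      exact Nat.mul_le_mul_left d (by omega)
    exact add_le_add (h3.trans h1) h2

lemma le_entropyBits {δ : ℝ} (h0 : 0 ≤ δ) (h1 : δ < 1 / 2) : δ ≤ entropyBits δ := by
  have hlog2 : 0 < Real.log 2 := Real.log_pos (by norm_num)
  rw [entropyBits, le_div_iff₀ hlog2, Real.binEntropy]
  have hrest : 0 ≤ (1 - δ) * Real.log (1 - δ)⁻¹ :=
    mul_nonneg (by linarith) (Real.log_nonneg ((one_le_inv₀ (by linarith)).2 (by linarith)))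
  rcases h0.eq_or_lt with rfl | hpos
  · simp
  have hlog : Real.log 2 ≤ Real.log δ⁻¹ := by
    refine Real.log_le_log (by norm_num) ?_
    rw [le_inv_comm₀ (by norm_num) hpos]
    linarith
  nlinarith

/-- The number of strings shorter than `n / 64`, times the size of a Hamming ball of radius `n / 128`,
is beaten by the probability that `n / 4` uniform samples lie in a set of density at most `3 / 5`. -/
lemma strings_mul_ball_mul_pow_le {n M : ℕ} {τ : ℝ} (hn : 256 ≤ n) (h0 : 0 ≤ τ) (hτ : τ ≤ 3 / 5)
    (hM : (n : ℝ) / 4 ≤ M) :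
    2 ^ ⌈(n : ℝ) / 64⌉₊ * (32 ^ ⌈(n : ℝ) / 128⌉₊ * (33 / 32 : ℝ) ^ n * τ ^ M) ≤ 1 / 4 := by
  have h1 : (2 : ℝ) ^ ⌈(n : ℝ) / 64⌉₊ ≤ 2 ^ ((n : ℝ) / 64 + 1) := by
    rw [← Real.rpow_natCast]
    exact Real.rpow_le_rpow_of_exponent_le (by norm_num)
      (Nat.ceil_lt_add_one (by positivity)).le
  have h2 : (32 : ℝ) ^ ⌈(n : ℝ) / 128⌉₊ ≤ 2 ^ (5 * ((n : ℝ) / 128 + 1)) := by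
    have h32 : ∀ x : ℝ, (2 : ℝ) ^ (5 * x) = 32 ^ x := by
      intro x
      rw [Real.rpow_mul (by norm_num)]
      norm_num
    rw [h32, ← Real.rpow_natCast]
    exact Real.rpow_le_rpow_of_exponent_le (by norm_num)
      (Nat.ceil_lt_add_one (by positivity)).le
  have h3 : (33 / 32 : ℝ) ^ n ≤ 2 ^ ((n : ℝ) / 16) := by
    have : (33 / 32 : ℝ) ^ n = ((33 / 32) ^ (16 : ℝ)) ^ ((n : ℝ) / 16) := by
      rw [← Real.rpow_mul (by norm_num), ← Real.rpow_natCast]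
      ring_nf
    rw [this]
    refine Real.rpow_le_rpow (by positivity) ?_ (by positivity)
    norm_num
  have h4 : τ ^ M ≤ 2 ^ (-5 * ((n : ℝ) / 32)) := by
    have h5 : (3 / 5 : ℝ) ^ ((n : ℝ) / 4) = ((3 / 5) ^ (8 : ℝ)) ^ ((n : ℝ) / 32) := by
      rw [← Real.rpow_mul (by norm_num)]
      ring_nf
    calc τ ^ M ≤ (3 / 5) ^ M := by gcongr
      _ = (3 / 5) ^ (M : ℝ) := (Real.rpow_natCast _ _).symm
      _ ≤ (3 / 5) ^ ((n : ℝ) / 4) :=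
        Real.rpow_le_rpow_of_exponent_ge (by norm_num) (by norm_num) hM
      _ ≤ (2 ^ (-5 : ℝ)) ^ ((n : ℝ) / 32) := by
        rw [h5]
        refine Real.rpow_le_rpow (by positivity) ?_ (by positivity)
        rw [Real.rpow_neg (by norm_num)]
        norm_num
      _ = _ := (Real.rpow_mul (by norm_num) _ _).symm
  calc _ ≤ (2 : ℝ) ^ ((n : ℝ) / 64 + 1) * (2 ^ (5 * ((n : ℝ) / 128 + 1)) * 2 ^ ((n : ℝ) / 16) *
        2 ^ (-5 * ((n : ℝ) / 32))) := by gcongr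
    _ = 2 ^ (6 - 5 * (n : ℝ) / 128) := by
        rw [← Real.rpow_add (by norm_num), ← Real.rpow_add (by norm_num),
          ← Real.rpow_add (by norm_num)]
        ring_nf
    _ ≤ 2 ^ (-2 : ℝ) := by
        refine Real.rpow_le_rpow_of_exponent_le (by norm_num) ?_
        have : (256 : ℝ) ≤ n := by exact_mod_cast hn
        linarith
    _ = 1 / 4 := by
        rw [Real.rpow_neg (by norm_num)]
        norm_num

/-- With `2 log d` expected occurrences of each of `d` points, all points occur between `1` and
`8 log d` times with probability at least `3 / 4`. -/
lemma union_bound_le {d K N : ℕ} {q : ℝ} (hd : 8 ≤ d) (hq0 : 0 ≤ q) (hq1 : q ≤ 1)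
    (hqN : q * N = 2 * Real.log d) (hK : 8 * Real.log d ≤ K) :
    (d : ℝ) * ((1 - q) ^ N + (q * 2 + (1 - q)) ^ N * (2 ^ K)⁻¹) ≤ 1 / 4 := by
  have hd0 : (0 : ℝ) < d := by exact_mod_cast (by omega : 0 < d)
  have hd8 : (8 : ℝ) ≤ d := by exact_mod_cast hd
  have hlog : 0 ≤ Real.log d := Real.log_nonneg (by linarith)
  have hexp : ∀ k : ℕ, Real.exp (k * Real.log d) = (d : ℝ) ^ k := by
    intro k
    rw [Real.exp_nat_mul, Real.exp_log hd0]
  have h1 : (1 - q) ^ N ≤ ((d : ℝ) ^ 2)⁻¹ := by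
    have := Real.add_one_le_exp (-q)
    calc (1 - q) ^ N ≤ Real.exp (-q) ^ N := by
          refine pow_le_pow_left₀ (by linarith) (by linarith) _
      _ = ((d : ℝ) ^ 2)⁻¹ := by
          rw [← Real.exp_nat_mul, ← hexp, ← Real.exp_neg]
          congr 1
          push_cast
          linarith
  have h2 : (q * 2 + (1 - q)) ^ N ≤ (d : ℝ) ^ 2 := by
    have := Real.add_one_le_exp q
    calc (q * 2 + (1 - q)) ^ N ≤ Real.exp q ^ N := by
          refine pow_le_pow_left₀ (by linarith) (by linarith) _
      _ = (d : ℝ) ^ 2 := by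
          rw [← Real.exp_nat_mul, ← hexp]
          congr 1
          push_cast
          linarith
  have h3 : ((2 : ℝ) ^ K)⁻¹ ≤ ((d : ℝ) ^ 5)⁻¹ := by
    refine inv_anti₀ (by positivity) ?_
    rw [← hexp, ← Real.exp_log (show (0 : ℝ) < 2 ^ K by positivity), Real.log_pow]
    refine Real.exp_le_exp.2 ?_
    have := Real.log_two_gt_d9
    push_cast
    nlinarith
  calc (d : ℝ) * ((1 - q) ^ N + (q * 2 + (1 - q)) ^ N * (2 ^ K)⁻¹)
      ≤ d * (((d : ℝ) ^ 2)⁻¹ + (d : ℝ) ^ 2 * ((d : ℝ) ^ 5)⁻¹) := by gcongr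
    _ = (d : ℝ)⁻¹ + (d : ℝ)⁻¹ * (d : ℝ)⁻¹ := by field_simp
    _ ≤ 8⁻¹ + 8⁻¹ * 1 := by
        gcongr
        exact inv_le_one_of_one_le₀ (by linarith)
    _ = 1 / 4 := by norm_num

lemma exists_forall_log_le :
    ∃ C : ℕ, 100 ≤ C ∧ ∀ d : ℕ, C ≤ d → 1 ≤ Real.log d ∧ 100 * Real.log d ≤ d := by
  have h1 : ∀ᶠ d : ℕ in Filter.atTop, 1 ≤ Real.log d :=
    (Real.tendsto_log_atTop.comp tendsto_natCast_atTop_atTop).eventually_ge_atTop 1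
  have h2 : ∀ᶠ d : ℕ in Filter.atTop, ‖Real.log d‖ ≤ 1 / 100 * ‖(d : ℝ)‖ :=
    tendsto_natCast_atTop_atTop.eventually
      (Real.isLittleO_log_id_atTop.bound (by norm_num : (0 : ℝ) < 1 / 100))
  obtain ⟨C, hC⟩ := Filter.eventually_atTop.1 (h1.and h2)
  refine ⟨max 100 C, le_max_left _ _, fun d hd => ?_⟩
  obtain ⟨h3, h4⟩ := hC d ((le_max_right _ _).trans hd)
  refine ⟨h3, ?_⟩
  rw [Real.norm_of_nonneg (by linarith), Real.norm_of_nonneg (by positivity)] at h4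
  linarith

/-! ### The lower bound -/

theorem mainTheorem9 :
    ∃ c₁ c a b : ℝ, 0 < c₁ ∧ 0 < c ∧ 0 < a ∧ 0 < b ∧ ∃ C : ℕ,
      ∀ d k' : ℕ, C ≤ d → 2 ≤ k' → k' + 2 ≤ d →
        ∃ (ρ : PMF (simplexDomain d × Bool)) (n₀ k : ℕ),
          ρ.support.ncard = d.choose k' + d ∧
          (d.choose k' : ℝ) / 2 ≤ n₀ ∧ n₀ ≤ d.choose k' ∧
          a * (k' * Real.log d) ≤ k ∧ (k : ℝ) ≤ b * (k' * Real.log d) ∧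
          ∀ ε δ : ℝ, 0 ≤ ε → 0 ≤ δ → δ < 1 / 2 →
            ∀ S : LUPair (simplexDomain d × Bool) Bool,
              S.IsScheme (realizabilityTesting (halfspaces (simplexDomain d)))
                (iidSamples ρ n₀) k ε δ →
              ENNReal.ofReal (c * (c₁ - entropyBits δ) * (d.choose k' : ℝ)) ≤
                S.expectedMemory (iidSamples ρ n₀) := by
  obtain ⟨C, hC100, hC⟩ := exists_forall_log_le
  refine ⟨1 / 1024, 1, 8, 9, by norm_num, by norm_num, by norm_num, by norm_num, C, ?_⟩
  intro d k' hCd hk2 hkd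
  obtain ⟨hlog1, hlogd⟩ := hC d hCd
  have hd100 : (100 : ℝ) ≤ d := by exact_mod_cast hC100.trans hCd
  set L := Real.log d with hL
  set n := d.choose k' with hn
  have hnd : (d : ℝ) * (d - 1) / 2 ≤ n := by
    rw [← Nat.cast_choose_two]
    exact_mod_cast choose_two_le_choose hk2 hkd
  have hn256 : 256 ≤ n := by
    have : (256 : ℝ) ≤ n := by nlinarith
    exact_mod_cast this
  have hnR : (256 : ℝ) ≤ n := by exact_mod_cast hn256
  obtain ⟨m, hd⟩ : ∃ m, d = k' + m := ⟨d - k', by omega⟩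
  have hm : 0 < m := by omega
  have hnm : d.choose m = n := by rw [hn, Nat.choose_symm_of_eq_add hd]
  set N := (n + 1) / 2 with hN
  have hNn : N ≤ n := by omega
  have hN1 : (n : ℝ) / 2 ≤ N := by
    have : (n : ℝ) ≤ 2 * N := by exact_mod_cast (by omega : n ≤ 2 * N)
    linarith
  have hN2 : (N : ℝ) ≤ ((n : ℝ) + 1) / 2 := by
    have : 2 * (N : ℝ) ≤ n + 1 := by exact_mod_cast (by omega : 2 * N ≤ n + 1)
    linarith
  have hN0 : (0 : ℝ) < N := by linarith
  set K := ⌈8 * L⌉₊ with hK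
  have hK1 : 8 * L ≤ K := Nat.le_ceil _
  have hK2 : (K : ℝ) ≤ 9 * L := by
    have := Nat.ceil_lt_add_one (show 0 ≤ 8 * L by linarith)
    linarith
  -- Each vertex has probability `q`, so that it occurs about `2 log d` times.
  set q := 2 * L / N with hq
  set p := (1 - d * q) / n with hp
  have hq0 : 0 < q := by positivity
  have hqN : q * N = 2 * L := div_mul_cancel₀ _ hN0.ne'
  have hdq : d * q ≤ 1 / 2 := by
    rw [hq, mul_div_assoc', div_le_iff₀ hN0]
    nlinarith
  have hq1 : q ≤ 1 := by nlinarith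
  have hp0 : 0 < p := div_pos (by linarith) (by linarith)
  have hsum : ∑ z : Fin d ⊕ {B : Finset (Fin d) // B.card = m},
      Sum.elim (fun _ => ENNReal.ofReal q) (fun _ => ENNReal.ofReal p) z = 1 := by
    have hcard : Fintype.card {B : Finset (Fin d) // B.card = m} = n := by simp [hnm]
    rw [Fintype.sum_sum_type]
    simp only [Sum.elim_inl, Sum.elim_inr, Finset.sum_const, Finset.card_univ, hcard,
      Fintype.card_fin, nsmul_eq_mul]
    rw [← ENNReal.ofReal_natCast d, ← ENNReal.ofReal_natCast n, ← ENNReal.ofReal_mul (by positivity),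
      ← ENNReal.ofReal_mul (by positivity), ← ENNReal.ofReal_add (by positivity) (by positivity),
      ← ENNReal.ofReal_one]
    congr 1
    rw [hp, mul_div_cancel₀ _ (by linarith)]
    ring
  set ν : PMF (Fin d ⊕ {B : Finset (Fin d) // B.card = m}) := PMF.ofFintype _ hsum with hν
  have hνq : ∀ j, ν (.inl j) = ENNReal.ofReal q := fun j => rfl
  have hνp : ∀ B, ν (.inr B) = ENNReal.ofReal p := fun B => rfl
  refine ⟨ν.map (hardPoint hm), N, k' * K, ?_, hN1, hNn, ?_, ?_, ?_⟩
  · have hsupp : ν.support = Set.univ := by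
      refine Set.eq_univ_of_forall fun z => ?_
      rw [PMF.mem_support_iff]
      rcases z with j | B
      · rw [hνq]
        simpa using hq0
      · rw [hνp]
        simpa using hp0
    rw [PMF.support_map, hsupp, Set.ncard_image_of_injective _ (hardPoint_injective hm),
      Set.ncard_univ, Nat.card_eq_fintype_card, Fintype.card_sum]
    simp [hnm, add_comm]
  · push_cast
    nlinarith [(Nat.cast_nonneg k' : (0 : ℝ) ≤ k')]
  · push_cast
    nlinarith [(Nat.cast_nonneg k' : (0 : ℝ) ≤ k')]
  intro ε δ _ hδ0 hδ1 S hS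
  have hent := le_entropyBits hδ0 hδ1
  by_cases hδ : 1 / 1024 ≤ entropyBits δ
  · rw [ENNReal.ofReal_of_nonpos]
    · exact zero_le
    · nlinarith
  push Not at hδ
  set ℓ := ⌈(n : ℝ) / 64⌉₊ with hℓ
  set r := ⌈(n : ℝ) / 128⌉₊ with hr
  have hℓn : (n : ℝ) / 64 ≤ ℓ := Nat.le_ceil _
  have hrn : (n : ℝ) / 128 ≤ r := Nat.le_ceil _
  have hℓ0 : (0 : ℝ) < ℓ := by linarith
  have hr0 : (0 : ℝ) < r := by linarith
  have hmain := one_le_memory_add hm (by omega) ν _ hνp (k := k' * K) (K := K)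
    (by rw [hd, Nat.add_sub_cancel]) (by rw [hnm]; exact hNn) (by exact_mod_cast hℓ0)
    (by exact_mod_cast hr0) hS
  rw [hnm] at hmain
  have hA : pmfExpect (iidSamples ν N) (fun D => open Classical in
      if IsBalanced K (leftPart D) then (0 : ℝ≥0∞) else 1) ≤ ENNReal.ofReal (1 / 4) := by
    refine (pmfExpect_not_isBalanced_le ν _ hνq K N).trans ?_
    refine le_of_eq_of_le ?_ (ENNReal.ofReal_le_ofReal
      (union_bound_le (by omega) hq0.le hq1 hqN hK1))
    have h1q : 0 ≤ 1 - q := by linarith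
    rw [ENNReal.ofReal_mul (by positivity), ENNReal.ofReal_add (by positivity) (by positivity),
      ENNReal.ofReal_mul (by positivity), ENNReal.ofReal_pow h1q, ENNReal.ofReal_pow (by positivity),
      ENNReal.ofReal_add (by positivity) h1q, ENNReal.ofReal_mul hq0.le,
      ENNReal.ofReal_sub _ hq0.le, ENNReal.ofReal_inv_of_pos (by positivity),
      ENNReal.ofReal_pow (by norm_num)]
    simp
  have hB : (n : ℝ≥0∞) * (2 * ENNReal.ofReal δ) * (r : ℝ≥0∞)⁻¹ ≤ ENNReal.ofReal (1 / 4) := by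
    have h : (n : ℝ) * (2 * δ) * (r : ℝ)⁻¹ ≤ 1 / 4 := by
      rw [← div_eq_mul_inv, div_le_iff₀ hr0]
      nlinarith
    refine le_of_eq_of_le ?_ (ENNReal.ofReal_le_ofReal h)
    rw [ENNReal.ofReal_mul (by positivity), ENNReal.ofReal_mul (by positivity),
      ENNReal.ofReal_mul (by norm_num), ENNReal.ofReal_inv_of_pos hr0]
    simp
  have hCount : 2 ^ ℓ * (ENNReal.ofReal (32 ^ r * (33 / 32) ^ n) *
      (N / n : ℝ≥0∞) ^ (N - d * K)) ≤ ENNReal.ofReal (1 / 4) := by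
    have hM : (n : ℝ) / 4 ≤ ((N - d * K : ℕ) : ℝ) := by
      have h1 : (N : ℝ) ≤ ((N - d * K : ℕ) : ℝ) + d * K := by
        exact_mod_cast (by omega : N ≤ N - d * K + d * K)
      nlinarith
    have hτ : (N / n : ℝ) ≤ 3 / 5 := by
      rw [div_le_iff₀ (by linarith)]
      linarith
    refine le_of_eq_of_le ?_ (ENNReal.ofReal_le_ofReal
      (strings_mul_ball_mul_pow_le hn256 (by positivity) hτ hM))
    rw [ENNReal.ofReal_mul (p := 2 ^ ℓ) (by positivity),
      ENNReal.ofReal_mul (p := 32 ^ r * (33 / 32) ^ n) (by positivity),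
      ENNReal.ofReal_pow (by norm_num), ENNReal.ofReal_pow (p := (N : ℝ) / n) (by positivity),
      ENNReal.ofReal_div_of_pos (by linarith)]
    simp
  -- The three alternatives to a large memory have total probability at most `3 / 4`.
  by_contra! hlt
  have hsmall : S.expectedMemory (iidSamples (ν.map (hardPoint hm)) N) * (ℓ : ℝ≥0∞)⁻¹ ≤
      ENNReal.ofReal (1 / 8) := by
    refine (mul_le_mul_left hlt.le _).trans ?_
    rw [← ENNReal.ofReal_natCast ℓ, ← ENNReal.ofReal_inv_of_pos hℓ0,
      ← ENNReal.ofReal_mul' (by positivity)]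
    refine ENNReal.ofReal_le_ofReal ?_
    rw [← div_eq_mul_inv, div_le_iff₀ hℓ0]
    nlinarith
  have hfin := hmain.trans (add_le_add hA (add_le_add (add_le_add hsmall hB) hCount))
  rw [← ENNReal.ofReal_add (by norm_num) (by norm_num),
    ← ENNReal.ofReal_add (by norm_num) (by norm_num),
    ← ENNReal.ofReal_add (by norm_num) (by norm_num), ENNReal.one_le_ofReal] at hfin
  norm_num at hfin
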